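/- Let $H_1, H_2, H_3$ be complex Hilbert spaces, and let $T_1\colon H_1\to H_2$ and $T_2\colon H_2\to H_3$ be densely defined closed linear operators with $\mathcal R(T_1)\subset\mathcal N(T_2)$, where $\mathcal R$ and $\mathcal N$ denote range and kernel. Let $T_1^*$ be the Hilbert space adjoint of $T_1$, and let $$Q(u,v)=(T_1^*u,T_1^*v)+(T_2u,T_2v),\qquad \operatorname{dom}(Q)=\operatorname{dom}(T_1^*)\cap\operatorname{dom}(T_2).$$ Let $\square$ be the non-negative self-adjoint operator on $H_2$ determined by the densely defined closed form $Q$: its domain consists of all $u\in\operatorname{dom}(Q)$ for which there is a (necessarily unique) $w\in H_2$ with $Q(u,v)=(w,v)$ for all $v\in\operatorname{dom}(Q)$, and $\square u=w$. Let $\operatorname{spec}(\square)$ be the spectrum of $\square$ and let $\operatorname{esspec}(\square)$ be its essential spectrum, i.e. the set of all $\lambda$ for which $\square-\lambda$ is not Fredholm (finite-dimensional kernel, closed range of finite codimension). The infimum of the empty set is $\infty$. (1) $\inf\operatorname{spec}(\square)>0$ if and only if $\mathcal R(T_2)$ is closed and $\mathcal R(T_1)=\mathcal N(T_2)$. (2)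 $\inf\operatorname{esspec}(\square)>0$ if and only if there exists a finite-dimensional subspace $L\subset\operatorname{dom}(Q)$ such that $\mathcal R(T_2|_{L^\perp})$ is closed and $\mathcal R(T_1)\cap L^\perp=\mathcal N(T_2)\cap L^\perp$, where $L^\perp$ is the orthogonal complement of $L$ in $H_2$ and $T_2|_{L^\perp}$ is the restriction of $T_2$ to $\operatorname{dom}(T_2)\cap L^\perp$. -/

import Mathlib

noncomputable section

open scoped LinearPMap InnerProductSpace

namespace SpectralLemma

section Operators

variable {E F : Type*}
  [NormedAddCommGroup E] [InnerProductSpace ℂ E]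
  [NormedAddCommGroup F] [InnerProductSpace ℂ F]

/-- The range of an unbounded operator. -/
def opRange (T : E →ₗ.[ℂ] F) : Submodule ℂ F := LinearMap.range T.toFun

/-- The kernel of an unbounded operator, as a subspace of the ambient space. -/
def opKer (T : E →ₗ.[ℂ] F) : Submodule ℂ E :=
  (LinearMap.ker T.toFun).map T.domain.subtype

/-- The operator `A - z`, with the domain of `A`. -/
def subScalar (A : E →ₗ.[ℂ] E) (z : ℂ) : E →ₗ.[ℂ] E :=
  ⟨A.domain, A.toFun - z • A.domain.subtype⟩

/-- `z` is in the resolvent set of `A`: the operator `A - z` has an everywhere defined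
bounded two-sided inverse `R`. -/
def IsResolventPoint (A : E →ₗ.[ℂ] E) (z : ℂ) : Prop :=
  ∃ R : E →L[ℂ] E,
    (∀ y : E, ∃ h : R y ∈ (subScalar A z).domain, subScalar A z ⟨R y, h⟩ = y) ∧
    ∀ x : (subScalar A z).domain, R (subScalar A z x) = x

/-- The spectrum of an unbounded operator. -/
def spec (A : E →ₗ.[ℂ] E) : Set ℂ := {z | ¬ IsResolventPoint A z}

/-- Fredholm operators: finite-dimensional kernel, closed range of finite codimension. -/
structure IsFredholmOp (T : E →ₗ.[ℂ] F) : Prop where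
  finite_ker : FiniteDimensional ℂ (opKer T)
  closed_range : IsClosed (opRange T : Set F)
  finite_coker : FiniteDimensional ℂ (F ⧸ opRange T)

/-- The essential spectrum: all `z` such that `A - z` is not Fredholm. -/
def essSpec (A : E →ₗ.[ℂ] E) : Set ℂ := {z | ¬ IsFredholmOp (subScalar A z)}

/-- The infimum of a set of spectral values, in the extended reals, so that the infimum of the
empty set is `∞`. It is only used for spectra of self-adjoint operators, which are real, so that
taking real parts just turns elements of `ℂ` into real numbers. -/
def infSet (S : Set ℂ) : EReal := sInf ((fun z : ℂ => (z.re : EReal)) '' S)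

theorem mem_opKer {T : E →ₗ.[ℂ] F} {x : E} :
    x ∈ opKer T ↔ ∃ h : x ∈ T.domain, T ⟨x, h⟩ = 0 := by
  simp [opKer, LinearPMap.toFun_eq_coe]

end Operators

section Form

variable {H₁ H₂ H₃ : Type*}
  [NormedAddCommGroup H₁] [InnerProductSpace ℂ H₁] [CompleteSpace H₁]
  [NormedAddCommGroup H₂] [InnerProductSpace ℂ H₂]
  [NormedAddCommGroup H₃] [InnerProductSpace ℂ H₃]

/-- The domain `dom(T₁*) ∩ dom(T₂)` of the form `Q`. -/
def formDomain (T₁ : H₁ →ₗ.[ℂ] H₂) (T₂ : H₂ →ₗ.[ℂ] H₃) : Submodule ℂ H₂ :=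
  T₁†.domain ⊓ T₂.domain

/-- The form `Q(u, v) = (T₁* u, T₁* v) + (T₂ u, T₂ v)`. -/
def form (T₁ : H₁ →ₗ.[ℂ] H₂) (T₂ : H₂ →ₗ.[ℂ] H₃) (u v : formDomain T₁ T₂) : ℂ :=
  ⟪T₁† ⟨u, u.2.1⟩, T₁† ⟨v, v.2.1⟩⟫_ℂ + ⟪T₂ ⟨u, u.2.2⟩, T₂ ⟨v, v.2.2⟩⟫_ℂ

theorem form_add_left (T₁ : H₁ →ₗ.[ℂ] H₂) (T₂ : H₂ →ₗ.[ℂ] H₃) (u u' v : formDomain T₁ T₂) :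
    form T₁ T₂ (u + u') v = form T₁ T₂ u v + form T₁ T₂ u' v := by
  have h1 : T₁† ⟨(u + u' : formDomain T₁ T₂), (u + u').2.1⟩
      = T₁† ⟨u, u.2.1⟩ + T₁† ⟨u', u'.2.1⟩ := T₁†.map_add ⟨u, u.2.1⟩ ⟨u', u'.2.1⟩
  have h2 : T₂ ⟨(u + u' : formDomain T₁ T₂), (u + u').2.2⟩
      = T₂ ⟨u, u.2.2⟩ + T₂ ⟨u', u'.2.2⟩ := T₂.map_add ⟨u, u.2.2⟩ ⟨u', u'.2.2⟩
  simp only [form, h1, h2, inner_add_left]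
  ring

theorem form_smul_left (T₁ : H₁ →ₗ.[ℂ] H₂) (T₂ : H₂ →ₗ.[ℂ] H₃) (c : ℂ)
    (u v : formDomain T₁ T₂) :
    form T₁ T₂ (c • u) v = (starRingEnd ℂ) c * form T₁ T₂ u v := by
  have h1 : T₁† ⟨(c • u : formDomain T₁ T₂), (c • u).2.1⟩ = c • T₁† ⟨u, u.2.1⟩ :=
    T₁†.map_smul c ⟨u, u.2.1⟩
  have h2 : T₂ ⟨(c • u : formDomain T₁ T₂), (c • u).2.2⟩ = c • T₂ ⟨u, u.2.2⟩ :=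
    T₂.map_smul c ⟨u, u.2.2⟩
  simp only [form, h1, h2, inner_smul_left]
  ring

/-- The graph of the operator associated with the form `Q`: all `(u, w)` with `u ∈ dom(Q)` and
`Q(u, v) = (w, v)` for every `v ∈ dom(Q)`. -/
def boxGraph (T₁ : H₁ →ₗ.[ℂ] H₂) (T₂ : H₂ →ₗ.[ℂ] H₃) : Submodule ℂ (H₂ × H₂) where
  carrier := {p | ∃ u : formDomain T₁ T₂, (u : H₂) = p.1 ∧
    ∀ v : formDomain T₁ T₂, form T₁ T₂ u v = ⟪p.2, (v : H₂)⟫_ℂ}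
  zero_mem' := ⟨0, rfl, fun v => by
    simpa using form_smul_left T₁ T₂ 0 0 v⟩
  add_mem' := by
    rintro p q ⟨u, hu, hu'⟩ ⟨w, hw, hw'⟩
    exact ⟨u + w, by simp [hu, hw], fun v => by
      simp [form_add_left, hu', hw']⟩
  smul_mem' := by
    rintro c p ⟨u, hu, hu'⟩
    exact ⟨c • u, by simp [hu], fun v => by
      rw [form_smul_left, hu', Prod.smul_snd, inner_smul_left]⟩

/-- The operator `□` determined by the form `Q`: its domain consists of the `u ∈ dom(Q)` for which
there is `w` with `Q(u, v) = (w, v)` for all `v ∈ dom(Q)`, and `□ u = w`.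
(Uniqueness of `w` and self-adjointness of `□` are proved below.) -/
def box (T₁ : H₁ →ₗ.[ℂ] H₂) (T₂ : H₂ →ₗ.[ℂ] H₃) : H₂ →ₗ.[ℂ] H₂ :=
  (boxGraph T₁ T₂).toLinearPMap

end Form

section WellDefined

variable {H₁ H₂ H₃ : Type*}
  [NormedAddCommGroup H₁] [InnerProductSpace ℂ H₁] [CompleteSpace H₁]
  [NormedAddCommGroup H₂] [InnerProductSpace ℂ H₂] [CompleteSpace H₂]
  [NormedAddCommGroup H₃] [InnerProductSpace ℂ H₃] [CompleteSpace H₃]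

theorem dense_of_forall_inner {K : Submodule ℂ H₂}
    (h : ∀ y : H₂, (∀ v ∈ K, ⟪v, y⟫_ℂ = 0) → y = 0) : Dense (K : Set H₂) := by
  rw [Submodule.dense_iff_topologicalClosure_eq_top, Submodule.topologicalClosure_eq_top_iff,
    Submodule.eq_bot_iff]
  exact fun y hy => h y fun v hv => (Submodule.mem_orthogonal _ _).1 hy v hv

/-- The adjoint of a densely defined closed operator is densely defined. (Mathlib's domain of the
adjoint makes sense, and is dense, even if `T` is not densely defined.) -/
theorem dense_adjoint_domain {T : H₁ →ₗ.[ℂ] H₂} (hc : T.IsClosed) : Dense (T†.domain : Set H₂) := by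
  apply dense_of_forall_inner
  intro y hy
  let G : Submodule ℂ (WithLp 2 (H₁ × H₂)) :=
    T.graph.comap (WithLp.linearEquiv 2 ℂ (H₁ × H₂)).toLinearMap
  have hG : IsClosed (G : Set (WithLp 2 (H₁ × H₂))) :=
    hc.preimage (WithLp.prod_continuous_ofLp 2 H₁ H₂)
  have : CompleteSpace G := hG.completeSpace_coe
  let p := WithLp.toLp 2 ((0 : H₁), y)
  obtain ⟨g, hg, r, hr, hpr⟩ := G.exists_add_mem_mem_orthogonal p
  obtain ⟨x, hx1, hx2⟩ := (LinearPMap.mem_graph_iff T).1 (show WithLp.ofLp g ∈ T.graph from hg)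
  have e1 : r.fst = -(x : H₁) := by
    have := congrArg (fun q => (WithLp.ofLp q).1) hpr
    simp only [p, WithLp.ofLp_add, Prod.fst_add] at this
    rw [hx1]; exact (neg_eq_of_add_eq_zero_right this.symm).symm
  have e2 : r.snd = y - T x := by
    have := congrArg (fun q => (WithLp.ofLp q).2) hpr
    simp only [p, WithLp.ofLp_add, Prod.snd_add] at this
    rw [hx2, this]; simp
  have orth : ∀ a : T.domain, ⟪(x : H₁), a⟫_ℂ = ⟪y - T x, T a⟫_ℂ := by
    intro a
    have h := (Submodule.mem_orthogonal' _ _).1 hr (WithLp.toLp 2 ((a : H₁), T a))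
      (show ((a : H₁), T a) ∈ T.graph from T.mem_graph a)
    rw [WithLp.prod_inner_apply] at h
    change ⟪r.fst, (a : H₁)⟫_ℂ + ⟪r.snd, T a⟫_ℂ = 0 at h
    rw [e1, e2, inner_neg_left] at h
    linear_combination -h
  have hz : y - T x ∈ T†.domain := LinearPMap.mem_adjoint_domain_of_exists _ ⟨x, orth⟩
  have h0 := hy _ hz
  have hxx := orth x
  have hs : ⟪y - T x, y - T x⟫_ℂ + ⟪(x : H₁), (x : H₁)⟫_ℂ = 0 := by
    rw [hxx, inner_sub_right, h0]; ring
  rw [inner_self_eq_norm_sq_to_K, inner_self_eq_norm_sq_to_K] at hs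
  have hs' : ‖y - T x‖ ^ 2 + ‖(x : H₁)‖ ^ 2 = 0 :=
    (RCLike.ofReal_eq_zero (K := ℂ)).1 (by push_cast; exact hs)
  have hx0 : (x : H₁) = 0 := by
    rw [← norm_eq_zero]; nlinarith [sq_nonneg ‖y - T x‖, sq_nonneg ‖(x : H₁)‖]
  have hy0 : y - T x = 0 := by
    rw [← norm_eq_zero]; nlinarith [sq_nonneg ‖y - T x‖, sq_nonneg ‖(x : H₁)‖]
  have : x = 0 := Subtype.ext hx0
  rw [this, LinearPMap.map_zero, sub_zero] at hy0
  exact hy0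

theorem isClosed_opKer {T : H₂ →ₗ.[ℂ] H₃} (hc : T.IsClosed) :
    IsClosed (opKer T : Set H₂) := by
  have : (opKer T : Set H₂) = (fun x => (x, (0 : H₃))) ⁻¹' (T.graph : Set (H₂ × H₃)) := by
    ext x
    simp [mem_opKer, LinearPMap.mem_graph_iff]
  rw [this]
  exact hc.preimage (by fun_prop)

theorem dense_formDomain {T₁ : H₁ →ₗ.[ℂ] H₂} {T₂ : H₂ →ₗ.[ℂ] H₃} (hc₁ : T₁.IsClosed)
    (hd₂ : Dense (T₂.domain : Set H₂)) (hc₂ : T₂.IsClosed)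
    (h : opRange T₁ ≤ opKer T₂) : Dense (formDomain T₁ T₂ : Set H₂) := by
  apply dense_of_forall_inner
  intro y hy
  have : CompleteSpace (opKer T₂) := (isClosed_opKer hc₂).completeSpace_coe
  have split : ∀ v : H₂, ∃ a ∈ opKer T₂, ∃ b ∈ (opKer T₂)ᗮ, v = a + b := fun v =>
    (opKer T₂).exists_add_mem_mem_orthogonal v
  have hb1 : ∀ b ∈ (opKer T₂)ᗮ, b ∈ T₁†.domain := fun b hb =>
    LinearPMap.mem_adjoint_domain_of_exists _ ⟨0, fun x => by
      rw [inner_zero_left]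
      exact ((Submodule.mem_orthogonal' _ _).1 hb _ (h ⟨x, rfl⟩)).symm⟩
  obtain ⟨p, hp, q, hq, rfl⟩ := split y
  have hp0 : p = 0 := by
    refine (dense_adjoint_domain hc₁).eq_zero_of_inner_left ℂ fun v hv => ?_
    obtain ⟨a, ha, b, hb, rfl⟩ := split v
    have hmem : a ∈ formDomain T₁ T₂ :=
      ⟨by simpa using T₁†.domain.sub_mem hv (hb1 b hb), (mem_opKer.1 ha).1⟩
    have h1 := hy a hmem
    rw [inner_add_right, (Submodule.mem_orthogonal _ _).1 hq a ha, add_zero] at h1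
    rw [inner_add_right, (Submodule.mem_orthogonal _ _).1 hb p hp, add_zero]
    exact inner_eq_zero_symm.1 h1
  have hq0 : q = 0 := by
    refine hd₂.eq_zero_of_inner_left ℂ fun v hv => ?_
    obtain ⟨a, ha, b, hb, rfl⟩ := split v
    have hmem : b ∈ formDomain T₁ T₂ :=
      ⟨hb1 b hb, by simpa using T₂.domain.sub_mem hv (mem_opKer.1 ha).1⟩
    have h1 := hy b hmem
    rw [hp0, zero_add] at h1
    rw [inner_add_right, (Submodule.mem_orthogonal' _ _).1 hq a ha, zero_add]
    exact inner_eq_zero_symm.1 h1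
  rw [hp0, hq0, add_zero]

/-- The operator `□` is well defined: its graph is exactly `boxGraph`. -/
theorem graph_box {T₁ : H₁ →ₗ.[ℂ] H₂} {T₂ : H₂ →ₗ.[ℂ] H₃} (hc₁ : T₁.IsClosed)
    (hd₂ : Dense (T₂.domain : Set H₂)) (hc₂ : T₂.IsClosed)
    (h : opRange T₁ ≤ opKer T₂) : (box T₁ T₂).graph = boxGraph T₁ T₂ := by
  apply Submodule.toLinearPMap_graph_eq
  rintro ⟨x, w⟩ ⟨u, hu, hw⟩ hx
  refine (dense_formDomain hc₁ hd₂ hc₂ h).eq_zero_of_inner_left ℂ fun v hv => ?_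
  have hu0 : u = 0 := Subtype.ext (hu.trans hx)
  rw [← hw ⟨v, hv⟩, hu0]
  simpa using form_smul_left T₁ T₂ 0 0 ⟨v, hv⟩

/-- Every `f` can be written as `u + □ u`. -/
theorem exists_boxGraph {T₁ : H₁ →ₗ.[ℂ] H₂} {T₂ : H₂ →ₗ.[ℂ] H₃}
    (hd₁ : Dense (T₁.domain : Set H₁)) (hc₂ : T₂.IsClosed) (f : H₂) :
    ∃ u, (u, f - u) ∈ boxGraph T₁ T₂ := by
  let V := WithLp 2 (H₂ × WithLp 2 (H₁ × H₃))
  let G : Submodule ℂ V :=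
    { carrier := {p | (p.fst, p.snd.fst) ∈ T₁†.graph ∧ (p.fst, p.snd.snd) ∈ T₂.graph}
      zero_mem' := ⟨T₁†.graph.zero_mem, T₂.graph.zero_mem⟩
      add_mem' := fun ha hb => ⟨T₁†.graph.add_mem ha.1 hb.1, T₂.graph.add_mem ha.2 hb.2⟩
      smul_mem' := fun c _ ha => ⟨T₁†.graph.smul_mem c ha.1, T₂.graph.smul_mem c ha.2⟩ }
  have hG : IsClosed (G : Set V) := by
    have c1 : Continuous fun p : V => (p.fst, p.snd.fst) := by fun_prop
    have c2 : Continuous fun p : V => (p.fst, p.snd.snd) := by fun_prop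
    exact ((LinearPMap.adjoint_isClosed hd₁).preimage c1).inter (hc₂.preimage c2)
  have : CompleteSpace G := hG.completeSpace_coe
  let p : V := WithLp.toLp 2 (f, 0)
  obtain ⟨g, hg, r, hr, hpr⟩ := G.exists_add_mem_mem_orthogonal p
  obtain ⟨⟨x, hx1, hx2⟩, ⟨x', hx1', hx2'⟩⟩ :=
    And.intro ((LinearPMap.mem_graph_iff _).1 hg.1) ((LinearPMap.mem_graph_iff _).1 hg.2)
  simp only at hx1 hx2 hx1' hx2'
  have hu : g.fst ∈ formDomain T₁ T₂ := ⟨hx1 ▸ x.2, hx1' ▸ x'.2⟩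
  refine ⟨g.fst, ⟨g.fst, hu⟩, rfl, fun v => ?_⟩
  have a1 : T₁† ⟨g.fst, hu.1⟩ = g.snd.fst := by
    rw [← hx2]; congr 1; exact Subtype.ext hx1.symm
  have a2 : T₂ ⟨g.fst, hu.2⟩ = g.snd.snd := by
    rw [← hx2']; congr 1; exact Subtype.ext hx1'.symm
  have hrp : r = p - g := by rw [hpr]; abel
  have h := (Submodule.mem_orthogonal' _ _).1 hr
    (WithLp.toLp 2 ((v : H₂), WithLp.toLp 2 (T₁† ⟨v, v.2.1⟩, T₂ ⟨v, v.2.2⟩)))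
    ⟨T₁†.mem_graph ⟨v, v.2.1⟩, T₂.mem_graph ⟨v, v.2.2⟩⟩
  rw [hrp, inner_sub_left, WithLp.prod_inner_apply, WithLp.prod_inner_apply,
    WithLp.prod_inner_apply, WithLp.prod_inner_apply] at h
  change (⟪f, (v : H₂)⟫_ℂ + (⟪(0 : H₁), _⟫_ℂ + ⟪(0 : H₃), _⟫_ℂ)) -
    (⟪g.fst, (v : H₂)⟫_ℂ + (⟪g.snd.fst, T₁† ⟨v, v.2.1⟩⟫_ℂ + ⟪g.snd.snd, T₂ ⟨v, v.2.2⟩⟫_ℂ)) = 0 at h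
  rw [inner_zero_left, inner_zero_left] at h
  simp only [form, a1, a2, inner_sub_left]
  linear_combination -h

/-- The operator `□` is self-adjoint. -/
theorem isSelfAdjoint_box {T₁ : H₁ →ₗ.[ℂ] H₂} {T₂ : H₂ →ₗ.[ℂ] H₃}
    (hd₁ : Dense (T₁.domain : Set H₁)) (hc₁ : T₁.IsClosed)
    (hd₂ : Dense (T₂.domain : Set H₂)) (hc₂ : T₂.IsClosed)
    (h : opRange T₁ ≤ opKer T₂) : IsSelfAdjoint (box T₁ T₂) := by
  have hgr := graph_box hc₁ hd₂ hc₂ h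
  have key : ∀ x : (box T₁ T₂).domain, ∃ u : formDomain T₁ T₂, (u : H₂) = x ∧
      ∀ v : formDomain T₁ T₂, form T₁ T₂ u v = ⟪box T₁ T₂ x, (v : H₂)⟫_ℂ := fun x => by
    have := (box T₁ T₂).mem_graph x
    rw [hgr] at this
    exact this
  have surj : ∀ f : H₂, ∃ x : (box T₁ T₂).domain, box T₁ T₂ x + x = f := fun f => by
    obtain ⟨u, hu⟩ := exists_boxGraph hd₁ hc₂ f
    rw [← hgr] at hu
    obtain ⟨x, hx, hx'⟩ := (LinearPMap.mem_graph_iff _).1 hu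
    simp only at hx hx'
    exact ⟨x, by rw [hx', hx]; simp⟩
  have symm : (box T₁ T₂).IsFormalAdjoint (box T₁ T₂) := by
    intro x y
    obtain ⟨u, hu, hu'⟩ := key x
    obtain ⟨v, hv, hv'⟩ := key y
    rw [← hv, ← hu' v, ← hu, ← inner_conj_symm, ← hv' u]
    simp only [form, map_add, inner_conj_symm]
  have dense : Dense ((box T₁ T₂).domain : Set H₂) := by
    apply dense_of_forall_inner
    intro y hy
    obtain ⟨x, rfl⟩ := surj y
    obtain ⟨u, hu, hu'⟩ := key x
    have h0 := hy x x.2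
    rw [inner_add_right, ← symm x x, ← hu, ← hu' u, form, inner_self_eq_norm_sq_to_K,
      inner_self_eq_norm_sq_to_K, inner_self_eq_norm_sq_to_K] at h0
    have h1 : ‖T₁† ⟨u, u.2.1⟩‖ ^ 2 + ‖T₂ ⟨u, u.2.2⟩‖ ^ 2 + ‖(u : H₂)‖ ^ 2 = 0 :=
      (RCLike.ofReal_eq_zero (K := ℂ)).1 (by push_cast; exact h0)
    have hu0 : (u : H₂) = 0 := by
      rw [← norm_eq_zero]
      nlinarith [sq_nonneg ‖T₁† ⟨u, u.2.1⟩‖, sq_nonneg ‖T₂ ⟨u, u.2.2⟩‖, sq_nonneg ‖(u : H₂)‖]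
    have hx0 : x = 0 := Subtype.ext (hu.symm.trans hu0)
    rw [hx0, LinearPMap.map_zero]
    simp
  have hle : box T₁ T₂ ≤ (box T₁ T₂)† := symm.le_adjoint dense
  rw [LinearPMap.isSelfAdjoint_def]
  refine (LinearPMap.eq_of_le_of_domain_eq hle (le_antisymm hle.1 fun y hy => ?_)).symm
  obtain ⟨x, hx⟩ := surj ((box T₁ T₂)† ⟨y, hy⟩ + y)
  have hyx : y - x = 0 := by
    obtain ⟨z, hz⟩ := surj (y - x)
    have e1 := LinearPMap.adjoint_isFormalAdjoint dense ⟨y, hy⟩ z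
    have e2 := symm x z
    have : ⟪y - (x : H₂), y - (x : H₂)⟫_ℂ = 0 := by
      nth_rewrite 2 [← hz]
      rw [inner_add_right, inner_sub_left, inner_sub_left, ← e1, ← e2]
      have := congrArg (fun w => ⟪w, (z : H₂)⟫_ℂ) hx
      simp only [inner_add_left] at this
      linear_combination -this
    exact inner_self_eq_zero.1 this
  rw [sub_eq_zero.1 hyx]
  exact x.2

end WellDefined

end SpectralLemma

end

noncomputable section

open scoped LinearPMap InnerProductSpace

namespace SpectralLemma

/-! ### Closed operators, their ranges, and finite-dimensional changes. -/

section General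

variable {E F : Type*}
  [NormedAddCommGroup E] [InnerProductSpace ℂ E]
  [NormedAddCommGroup F] [InnerProductSpace ℂ F]

/-! Both equivalences reduce to the range of `□` near the spectral value 0. The kernel of `□` is the
harmonic space N(T₁*) ∩ N(T₂). Since R(T₁) ⊂ N(T₂), T₁* vanishes on N(T₂)ᗮ; splitting along N(T₂)
therefore decouples the form: T₁* sees only the component in N(T₂), T₂ only the other one.

If `□` has closed range, self-adjointness makes that range (ker □)ᗮ. Solving `□ u = f` with f ∈
N(T₂) gives f = T₁(T₁* u), so N(T₂) ∩ (ker □)ᗮ = R(T₁) (`opKer_inf_orthogonal_opKer_box`); solving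
it with f ∈ N(T₂)ᗮ bounds T₂ from below there, so R(T₂) is closed (`isClosed_opRange_of_box`).
Positivity of either infimum enters only through 0 not lying in the set. In (1) ker □ is zero, and
in (2) L = ker □ works.

Conversely, closed ranges of T₁ and T₂ give Q(u, u) ≥ ε‖u‖² on (ker □)ᗮ (`exists_form_bound`). Hence
every z ≠ 0 with Re z < ε is a resolvent point (`isResolventPoint_of_re_inner_ge`), and at z = 0 the
outcome depends only on ker □: a resolvent point if it is zero, Fredholm if it is
finite-dimensional. In (2), passing from Lᗮ to the whole space changes the relevant subspaces by
finite dimensions only. -/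

theorem mem_opKer_iff_graph {T : E →ₗ.[ℂ] F} {x : E} : x ∈ opKer T ↔ (x, (0 : F)) ∈ T.graph := by
  simp [mem_opKer, LinearPMap.mem_graph_iff]

theorem mem_opRange_iff_graph {T : E →ₗ.[ℂ] F} {y : F} :
    y ∈ opRange T ↔ ∃ x, (x, y) ∈ T.graph := by
  simp [opRange, LinearPMap.mem_graph_iff, LinearPMap.toFun_eq_coe]

theorem mem_graph_subScalar {A : E →ₗ.[ℂ] E} {z : ℂ} {x y : E} :
    (x, y) ∈ (subScalar A z).graph ↔ (x, y + z • x) ∈ A.graph := by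
  simp only [LinearPMap.mem_graph_iff]
  constructor
  · rintro ⟨u, rfl, rfl⟩
    exact ⟨u, rfl, (sub_add_cancel (A u) (z • (u : E))).symm⟩
  · rintro ⟨u, rfl, hu⟩
    exact ⟨u, rfl, (sub_eq_of_eq_add hu : A u - z • (u : E) = y)⟩

theorem subScalar_zero (A : E →ₗ.[ℂ] E) : subScalar A 0 = A :=
  LinearPMap.eq_of_eq_graph <| by
    ext ⟨x, y⟩
    rw [mem_graph_subScalar, zero_smul, add_zero]

theorem isClosed_subScalar {A : E →ₗ.[ℂ] E} (hA : A.IsClosed) (z : ℂ) :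
    (subScalar A z).IsClosed := by
  have : ((subScalar A z).graph : Set (E × E)) =
      (fun p => (p.1, p.2 + z • p.1)) ⁻¹' (A.graph : Set (E × E)) := by
    ext ⟨x, y⟩
    exact mem_graph_subScalar
  rw [LinearPMap.IsClosed, this]
  exact hA.preimage (by fun_prop)

theorem mem_graph_adjoint_iff [CompleteSpace E] {T : E →ₗ.[ℂ] F}
    (hd : Dense (T.domain : Set E)) {x : F} {y : E} :
    (x, y) ∈ T†.graph ↔ ∀ a b, (a, b) ∈ T.graph → ⟪x, b⟫_ℂ = ⟪y, a⟫_ℂ := by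
  rw [LinearPMap.adjoint_graph_eq_graph_adjoint hd, Submodule.mem_adjoint_iff]
  refine forall₃_congr fun a b _ => ?_
  rw [sub_eq_zero, ← inner_conj_symm b, ← inner_conj_symm a]
  exact (starRingEnd ℂ).injective.eq_iff

/-- A closed operator with closed range has a bounded right inverse on its range. -/
theorem exists_preimage_norm_le_of_isClosed_opRange [CompleteSpace E] [CompleteSpace F]
    {T : E →ₗ.[ℂ] F} (hc : T.IsClosed) (hr : IsClosed (opRange T : Set F)) :
    ∃ C > 0, ∀ y ∈ opRange T, ∃ x, (x, y) ∈ T.graph ∧ ‖x‖ ≤ C * ‖y‖ := by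
  have : CompleteSpace T.graph := IsClosed.completeSpace_coe (hs := hc)
  have : CompleteSpace (opRange T) := hr.completeSpace_coe
  let f : T.graph →L[ℂ] opRange T :=
    ((ContinuousLinearMap.snd ℂ E F).comp T.graph.subtypeL).codRestrict (opRange T) fun p =>
      mem_opRange_iff_graph.2 ⟨p.1.1, p.2⟩
  have hf : Function.Surjective f := fun y => by
    obtain ⟨x, hx⟩ := mem_opRange_iff_graph.1 y.2
    exact ⟨⟨(x, y), hx⟩, rfl⟩
  obtain ⟨C, hC, hfC⟩ := f.exists_preimage_norm_le hf
  refine ⟨C, hC, fun y hy => ?_⟩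
  obtain ⟨p, hp, hpC⟩ := hfC ⟨y, hy⟩
  have hpy : p.1.2 = y := congrArg Subtype.val hp
  exact ⟨p.1.1, hpy ▸ p.2, (norm_fst_le p.1).trans hpC⟩

/-- The splitting of a graph element along the kernel. -/
theorem exists_ker_add_orthogonal [CompleteSpace E] [CompleteSpace F] {T : E →ₗ.[ℂ] F}
    (hc : T.IsClosed) {x : E} {y : F} (hxy : (x, y) ∈ T.graph) :
    ∃ k ∈ opKer T, ∃ v ∈ (opKer T)ᗮ, x = k + v ∧ (v, y) ∈ T.graph := by
  have : CompleteSpace (opKer T) := (isClosed_opKer hc).completeSpace_coe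
  obtain ⟨k, hk, v, hv, rfl⟩ := (opKer T).exists_add_mem_mem_orthogonal x
  refine ⟨k, hk, v, hv, rfl, ?_⟩
  simpa using T.graph.sub_mem hxy (mem_opKer_iff_graph.1 hk)

/-- A closed operator that is bounded below on the complement of its kernel has closed range. -/
theorem isClosed_opRange_of_bound [CompleteSpace E] [CompleteSpace F]
    {T : E →ₗ.[ℂ] F} (hc : T.IsClosed) {c : ℝ} (hc0 : 0 < c)
    (hb : ∀ x y, (x, y) ∈ T.graph → x ∈ (opKer T)ᗮ → c * ‖x‖ ≤ ‖y‖) :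
    IsClosed (opRange T : Set F) := by
  let S : Submodule ℂ (E × F) :=
    T.graph ⊓ (opKer T)ᗮ.comap (LinearMap.fst ℂ E F)
  have hS : IsClosed (S : Set (E × F)) :=
    IsClosed.inter hc ((Submodule.isClosed_orthogonal _).preimage continuous_fst)
  have : CompleteSpace S := hS.completeSpace_coe
  let f : S →L[ℂ] F := (ContinuousLinearMap.snd ℂ E F).comp S.subtypeL
  -- The graph carries the sup norm, so both coordinates must be bounded by `‖y‖`: the first with
  -- factor c⁻¹, the second with factor 1.
  have hf : AntilipschitzWith (Real.toNNReal (max c⁻¹ 1)) f := by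
    refine f.antilipschitz_of_bound fun p => ?_
    have h1 := hb p.1.1 p.1.2 p.2.1 p.2.2
    rw [Real.coe_toNNReal _ (le_max_of_le_right zero_le_one)]
    change max ‖p.1.1‖ ‖p.1.2‖ ≤ max c⁻¹ 1 * ‖p.1.2‖
    refine max_le ?_ ?_
    · refine le_trans ?_ (mul_le_mul_of_nonneg_right (le_max_left _ _) (norm_nonneg _))
      rwa [inv_mul_eq_div, le_div_iff₀ hc0, mul_comm]
    · exact le_mul_of_one_le_left (norm_nonneg _) (le_max_right _ _)
  have hr : (opRange T : Set F) = Set.range f := by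
    ext y
    rw [SetLike.mem_coe, mem_opRange_iff_graph]
    constructor
    · rintro ⟨x, hx⟩
      obtain ⟨k, -, v, hv, -, hvy⟩ := exists_ker_add_orthogonal hc hx
      exact ⟨⟨(v, y), hvy, hv⟩, rfl⟩
    · rintro ⟨p, rfl⟩
      exact ⟨p.1.1, p.2.1⟩
  rw [hr]
  exact hf.isClosed_range f.uniformContinuous

/-- A closed densely defined operator contains its double adjoint. -/
theorem mem_graph_of_forall_adjoint [CompleteSpace E] [CompleteSpace F] {T : E →ₗ.[ℂ] F}
    (hd : Dense (T.domain : Set E)) (hc : T.IsClosed) {g : E} {f : F}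
    (hfg : ∀ v w, (v, w) ∈ T†.graph → ⟪f, v⟫_ℂ = ⟪g, w⟫_ℂ) : (g, f) ∈ T.graph := by
  let G : Submodule ℂ (WithLp 2 (E × F)) :=
    T.graph.comap (WithLp.linearEquiv 2 ℂ (E × F)).toLinearMap
  have hG : IsClosed (G : Set (WithLp 2 (E × F))) :=
    hc.preimage (WithLp.prod_continuous_ofLp 2 E F)
  have : CompleteSpace G := hG.completeSpace_coe
  -- A closed graph in the Hilbert sum equals its double orthogonal complement, and its complement
  -- is the graph of `T†` with coordinates swapped and one sign changed.
  suffices hp : WithLp.toLp 2 (g, f) ∈ Gᗮᗮ by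
    rw [Submodule.orthogonal_orthogonal] at hp
    exact hp
  refine (Submodule.mem_orthogonal' _ _).2 fun r hr => ?_
  have hr' : (r.snd, -r.fst) ∈ T†.graph := (mem_graph_adjoint_iff hd).2 fun a b hab => by
    have h := (Submodule.mem_orthogonal' _ _).1 hr (WithLp.toLp 2 (a, b)) hab
    rw [WithLp.prod_inner_apply] at h
    change ⟪r.fst, a⟫_ℂ + ⟪r.snd, b⟫_ℂ = 0 at h
    rw [inner_neg_left]
    linear_combination h
  have h := hfg _ _ hr'
  rw [inner_neg_right] at h
  rw [WithLp.prod_inner_apply]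
  change ⟪g, r.fst⟫_ℂ + ⟪f, r.snd⟫_ℂ = 0
  linear_combination h

/-- The orthogonal projection onto `L` is injective on `W`, its kernel being `Lᗮ`. -/
theorem finiteDimensional_of_inf_orthogonal_eq_bot {W L : Submodule ℂ E}
    [FiniteDimensional ℂ L] (hWL : W ⊓ Lᗮ = ⊥) : FiniteDimensional ℂ W := by
  let f : W →ₗ[ℂ] L := (L.orthogonalProjectionOnto : E →ₗ[ℂ] L).comp W.subtype
  refine FiniteDimensional.of_injective f ((injective_iff_map_eq_zero f).2 fun x hx => ?_)
  have hx' : (x : E) ∈ W ⊓ Lᗮ := ⟨x.2, L.orthogonalProjectionOnto_eq_zero_iff.1 hx⟩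
  rw [hWL] at hx'
  exact Subtype.ext ((Submodule.mem_bot ℂ).1 hx')

/-- The complement of `W ⊓ Lᗮ` inside `W` meets `Lᗮ` trivially, so it is finite-dimensional, and a
closed subspace plus a finite-dimensional one is closed. -/
theorem isClosed_of_inf_orthogonal [CompleteSpace E] {W L : Submodule ℂ E}
    [FiniteDimensional ℂ L] (hWL : IsClosed ((W ⊓ Lᗮ : Submodule ℂ E) : Set E)) :
    IsClosed (W : Set E) := by
  have : CompleteSpace (W ⊓ Lᗮ : Submodule ℂ E) := hWL.completeSpace_coe
  have hfin : FiniteDimensional ℂ ((W ⊓ Lᗮ)ᗮ ⊓ W : Submodule ℂ E) := by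
    refine finiteDimensional_of_inf_orthogonal_eq_bot (L := L) ((Submodule.eq_bot_iff _).2 ?_)
    rintro x ⟨⟨hx, hxW⟩, hxL⟩
    exact inner_self_eq_zero.1 ((Submodule.mem_orthogonal _ _).1 hx x ⟨hxW, hxL⟩)
  rw [← Submodule.sup_orthogonal_inf_of_hasOrthogonalProjection (K₁ := W ⊓ Lᗮ) (K₂ := W)
    inf_le_left]
  exact Submodule.isClosed_sup_finiteDimensional _ _ hWL

/-- Because `L` lies in the domain, both components of a domain vector stay in the domain; the full
range is then the restricted range plus the finite-dimensional image of `L`. -/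
theorem isClosed_opRange_of_domRestrict {T : E →ₗ.[ℂ] F} {L : Submodule ℂ E}
    [FiniteDimensional ℂ L] (hL : L ≤ T.domain)
    (hr : IsClosed (opRange (T.domRestrict Lᗮ) : Set F)) : IsClosed (opRange T : Set F) := by
  let f : L →ₗ[ℂ] F := T.toFun.comp (Submodule.inclusion hL)
  have hsup : opRange T = opRange (T.domRestrict Lᗮ) ⊔ LinearMap.range f := by
    apply le_antisymm
    · rintro _ ⟨x, rfl⟩
      obtain ⟨k, hk, v, hv, hkv⟩ := L.exists_add_mem_mem_orthogonal (x : E)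
      have hvd : v ∈ T.domain := by
        have := T.domain.sub_mem x.2 (hL hk)
        rwa [hkv, add_sub_cancel_left] at this
      have hx : x = ⟨v, hvd⟩ + ⟨k, hL hk⟩ := Subtype.ext (hkv.trans (add_comm _ _))
      rw [hx, map_add]
      exact Submodule.add_mem_sup ⟨⟨v, hv, hvd⟩, rfl⟩ ⟨⟨k, hk⟩, rfl⟩
    · refine sup_le ?_ ?_
      · rintro _ ⟨x, rfl⟩
        exact ⟨⟨x, x.2.2⟩, rfl⟩
      · rintro _ ⟨x, rfl⟩
        exact ⟨⟨x, hL x.2⟩, rfl⟩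
  rw [hsup]
  exact Submodule.isClosed_sup_finiteDimensional _ _ hr

theorem opRange_domRestrict_of_le_opKer {T : E →ₗ.[ℂ] F} {L : Submodule ℂ E}
    [L.HasOrthogonalProjection] (hL : L ≤ opKer T) :
    opRange (T.domRestrict Lᗮ) = opRange T := by
  apply le_antisymm
  · rintro _ ⟨x, rfl⟩
    exact ⟨⟨x, x.2.2⟩, rfl⟩
  · intro y hy
    obtain ⟨x, hx⟩ := mem_opRange_iff_graph.1 hy
    obtain ⟨k, hk, v, hv, rfl⟩ := L.exists_add_mem_mem_orthogonal x
    have hvy : (v, y) ∈ T.graph := by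
      simpa using T.graph.sub_mem hx (mem_opKer_iff_graph.1 (hL hk))
    obtain ⟨u, rfl, rfl⟩ := (LinearPMap.mem_graph_iff _).1 hvy
    exact ⟨⟨u, hv, u.2⟩, rfl⟩

theorem zero_notMem_of_infSet_pos {S : Set ℂ} (hS : 0 < infSet S) : (0 : ℂ) ∉ S := fun h0 =>
  hS.not_ge (sInf_le ⟨0, h0, by simp⟩)

theorem infSet_pos {S : Set ℂ} {ε : ℝ} (hε : 0 < ε) (hS : ∀ z ∈ S, ε ≤ z.re) : 0 < infSet S := by
  refine lt_of_lt_of_le (EReal.coe_pos.2 hε) (le_sInf ?_)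
  rintro _ ⟨z, hz, rfl⟩
  exact EReal.coe_le_coe_iff.2 (hS z hz)

end General

/-! ### Resolvent points and Fredholmness of self-adjoint operators. -/

section SelfAdjoint

variable {E : Type*} [NormedAddCommGroup E] [InnerProductSpace ℂ E]

theorem IsResolventPoint.opKer_eq_bot {A : E →ₗ.[ℂ] E} {z : ℂ} (h : IsResolventPoint A z) :
    opKer (subScalar A z) = ⊥ := by
  obtain ⟨R, -, hR⟩ := h
  refine (Submodule.eq_bot_iff _).2 fun x hx => ?_
  obtain ⟨hx, hx0⟩ := mem_opKer.1 hx
  have := hR ⟨x, hx⟩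
  rw [hx0, map_zero] at this
  exact this.symm

theorem IsResolventPoint.opRange_eq_top {A : E →ₗ.[ℂ] E} {z : ℂ} (h : IsResolventPoint A z) :
    opRange (subScalar A z) = ⊤ := by
  obtain ⟨R, hR, -⟩ := h
  refine Submodule.eq_top_iff'.2 fun y => ?_
  obtain ⟨hy, hy'⟩ := hR y
  exact ⟨⟨R y, hy⟩, hy'⟩

theorem IsResolventPoint.isFredholmOp {A : E →ₗ.[ℂ] E} {z : ℂ} (h : IsResolventPoint A z) :
    IsFredholmOp (subScalar A z) where
  finite_ker := by rw [h.opKer_eq_bot]; infer_instance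
  closed_range := by rw [h.opRange_eq_top]; exact isClosed_univ
  finite_coker := by rw [h.opRange_eq_top]; infer_instance

/-- Cauchy–Schwarz applied to the real part of (y - zx, x). -/
theorem norm_sub_smul_ge_of_re_inner_ge {z : ℂ} {x y : E} {ε : ℝ}
    (h : ε * ‖x‖ ^ 2 ≤ (⟪y, x⟫_ℂ).re) : (ε - z.re) * ‖x‖ ≤ ‖y - z • x‖ := by
  rcases eq_or_ne x 0 with rfl | hx
  · simp
  have h1 : (⟪y - z • x, x⟫_ℂ).re = (⟪y, x⟫_ℂ).re - z.re * ‖x‖ ^ 2 := by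
    rw [inner_sub_left, inner_smul_left, inner_self_eq_norm_sq_to_K, Complex.sub_re]
    have : (starRingEnd ℂ) z * (‖x‖ : ℂ) ^ 2 = ((‖x‖ ^ 2 : ℝ) : ℂ) * (starRingEnd ℂ) z := by
      push_cast
      ring
    erw [this]
    rw [Complex.re_ofReal_mul, Complex.conj_re]
    ring
  have h2 : (⟪y - z • x, x⟫_ℂ).re ≤ ‖y - z • x‖ * ‖x‖ :=
    re_inner_le_norm (𝕜 := ℂ) _ _
  have hx' : 0 < ‖x‖ := norm_pos_iff.2 hx
  refine le_of_mul_le_mul_right ?_ hx'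
  nlinarith

variable [CompleteSpace E]

theorem mem_graph_iff_of_isSelfAdjoint {A : E →ₗ.[ℂ] E} (hA : IsSelfAdjoint A) {x y : E} :
    (x, y) ∈ A.graph ↔ ∀ a b, (a, b) ∈ A.graph → ⟪x, b⟫_ℂ = ⟪y, a⟫_ℂ := by
  rw [← mem_graph_adjoint_iff hA.dense_domain, LinearPMap.isSelfAdjoint_def.1 hA]

/-- The range of `A - z` is orthogonal exactly to the eigenvectors for the eigenvalue `z̄`. -/
theorem mem_orthogonal_opRange_subScalar {A : E →ₗ.[ℂ] E} (hA : IsSelfAdjoint A) {z : ℂ} {y : E} :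
    y ∈ (opRange (subScalar A z))ᗮ ↔ (y, (starRingEnd ℂ) z • y) ∈ A.graph := by
  rw [mem_graph_iff_of_isSelfAdjoint hA, Submodule.mem_orthogonal']
  constructor
  · intro h a b hab
    have := h (b - z • a) (mem_opRange_iff_graph.2 ⟨a, mem_graph_subScalar.2 (by simpa using hab)⟩)
    rw [inner_sub_right, inner_smul_right] at this
    rw [inner_smul_left, Complex.conj_conj]
    linear_combination this
  · intro h b hb
    obtain ⟨a, ha⟩ := mem_opRange_iff_graph.1 hb
    have := h _ _ (mem_graph_subScalar.1 ha)
    rw [inner_add_right, inner_smul_right, inner_smul_left, Complex.conj_conj] at this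
    linear_combination this

/-- A self-adjoint operator with `A - z` and `A - z̄` bounded below has `z` in its
resolvent set. -/
theorem isResolventPoint_of_bound {A : E →ₗ.[ℂ] E} (hA : IsSelfAdjoint A) {z : ℂ} {c c' : ℝ}
    (hc : 0 < c) (hc' : 0 < c') (hb : ∀ x y, (x, y) ∈ A.graph → c * ‖x‖ ≤ ‖y - z • x‖)
    (hb' : ∀ x y, (x, y) ∈ A.graph → c' * ‖x‖ ≤ ‖y - (starRingEnd ℂ) z • x‖) :
    IsResolventPoint A z := by
  have hbz : ∀ x y, (x, y) ∈ (subScalar A z).graph → c * ‖x‖ ≤ ‖y‖ := fun x y hxy => by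
    simpa using hb _ _ (mem_graph_subScalar.1 hxy)
  have hcl : IsClosed (opRange (subScalar A z) : Set E) :=
    isClosed_opRange_of_bound (isClosed_subScalar hA.isClosed z) hc fun x y hxy _ => hbz x y hxy
  have : CompleteSpace (opRange (subScalar A z)) := hcl.completeSpace_coe
  have htop : opRange (subScalar A z) = ⊤ := by
    rw [← Submodule.orthogonal_eq_bot_iff, Submodule.eq_bot_iff]
    intro y hy
    have := hb' _ _ ((mem_orthogonal_opRange_subScalar hA).1 hy)
    rw [sub_self, norm_zero] at this
    exact norm_le_zero_iff.1 (nonpos_of_mul_nonpos_right this hc')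
  have hinj : Function.Injective (subScalar A z).toFun :=
    (injective_iff_map_eq_zero _).2 fun x hx => by
      have := hbz x 0 ((LinearPMap.mem_graph_iff _).2 ⟨x, rfl, hx⟩)
      rw [norm_zero] at this
      exact Subtype.ext (norm_le_zero_iff.1 (nonpos_of_mul_nonpos_right this hc))
  let e : (subScalar A z).domain ≃ₗ[ℂ] E :=
    LinearEquiv.ofBijective (subScalar A z).toFun ⟨hinj, LinearMap.range_eq_top.1 htop⟩
  have he : ∀ y, subScalar A z (e.symm y) = y := fun y => e.apply_symm_apply y
  let R : E →L[ℂ] E :=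
    ((subScalar A z).domain.subtype.comp e.symm.toLinearMap).mkContinuous c⁻¹ fun y => by
      have := hbz (e.symm y) y ((LinearPMap.mem_graph_iff _).2 ⟨e.symm y, rfl, he y⟩)
      rw [inv_mul_eq_div, le_div_iff₀ hc, mul_comm]
      exact this
  exact ⟨R, fun y => ⟨(e.symm y).2, he y⟩, fun x => congrArg Subtype.val (e.symm_apply_apply x)⟩

theorem orthogonal_opRange_of_isSelfAdjoint {A : E →ₗ.[ℂ] E} (hA : IsSelfAdjoint A) :
    (opRange A)ᗮ = opKer A := by
  ext y
  have := mem_orthogonal_opRange_subScalar hA (z := 0) (y := y)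
  rwa [subScalar_zero, map_zero, zero_smul, ← mem_opKer_iff_graph] at this

/-- A self-adjoint operator with finite-dimensional kernel and closed range is Fredholm. -/
theorem isFredholmOp_of_isSelfAdjoint {A : E →ₗ.[ℂ] E} (hA : IsSelfAdjoint A)
    (hk : FiniteDimensional ℂ (opKer A)) (hr : IsClosed (opRange A : Set E)) : IsFredholmOp A where
  finite_ker := hk
  closed_range := hr
  finite_coker := by
    have : CompleteSpace (opRange A) := hr.completeSpace_coe
    have : FiniteDimensional ℂ (opRange A)ᗮ :=
      (orthogonal_opRange_of_isSelfAdjoint hA).symm ▸ hk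
    exact (Submodule.quotientEquivOfIsCompl _ _
      (Submodule.isCompl_orthogonal (K := opRange A))).symm.finiteDimensional

/-- If a self-adjoint operator is bounded from below by `ε` off its kernel, then every `z ≠ 0`
with `Re z < ε` is in the resolvent set, and so is `z = 0` if the kernel vanishes. -/
theorem isResolventPoint_of_re_inner_ge {A : E →ₗ.[ℂ] E} (hA : IsSelfAdjoint A) {ε : ℝ}
    (hε : ∀ x y, (x, y) ∈ A.graph → x ∈ (opKer A)ᗮ → ε * ‖x‖ ^ 2 ≤ (⟪y, x⟫_ℂ).re)
    {z : ℂ} (hz : z.re < ε) (hz0 : z ≠ 0 ∨ opKer A = ⊥) : IsResolventPoint A z := by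
  -- On the kernel `A - z` acts as -z, so `m` may be ‖z‖ when z ≠ 0 and any positive number when the
  -- kernel is trivial.
  obtain ⟨m, hm, hmk⟩ : ∃ m > 0, ∀ k ∈ opKer A, m * ‖k‖ ≤ ‖z‖ * ‖k‖ := by
    rcases hz0 with hz0 | hbot
    · exact ⟨‖z‖, norm_pos_iff.2 hz0, fun k _ => le_rfl⟩
    · refine ⟨1, one_pos, fun k hk => ?_⟩
      rw [hbot, Submodule.mem_bot] at hk
      simp [hk]
  -- Only the real part and the modulus of `z` matter, so one estimate serves both z and its
  -- conjugate.
  have key : ∀ w : ℂ, w.re = z.re → ‖w‖ = ‖z‖ → ∀ x y, (x, y) ∈ A.graph →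
      min m (ε - z.re) * ‖x‖ ≤ ‖y - w • x‖ := by
    intro w hwre hwn x y hxy
    obtain ⟨k, hk, v, hv, rfl, hvy⟩ := exists_ker_add_orthogonal hA.isClosed hxy
    have hyk : ⟪k, y⟫_ℂ = 0 := by
      rw [(mem_graph_iff_of_isSelfAdjoint hA).1 (mem_opKer_iff_graph.1 hk) _ _ hxy,
        inner_zero_left]
    have hvk : ⟪k, v⟫_ℂ = 0 := (Submodule.mem_orthogonal _ _).1 hv k hk
    have e1 : ‖k + v‖ ^ 2 = ‖k‖ ^ 2 + ‖v‖ ^ 2 := by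
      simpa [sq] using norm_add_sq_eq_norm_sq_add_norm_sq_of_inner_eq_zero k v hvk
    -- The kernel and its complement reduce `A`: -w k and y - w v are orthogonal, so the bounds on
    -- the two pieces combine by Pythagoras.
    have e2 : ‖y - w • (k + v)‖ ^ 2 = (‖z‖ * ‖k‖) ^ 2 + ‖y - w • v‖ ^ 2 := by
      have hs : y - w • (k + v) = -(w • k) + (y - w • v) := by rw [smul_add]; abel
      have ho : ⟪-(w • k), y - w • v⟫_ℂ = 0 := by
        rw [inner_neg_left, inner_smul_left, inner_sub_right, inner_smul_right, hyk, hvk]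
        simp
      have := norm_add_sq_eq_norm_sq_add_norm_sq_of_inner_eq_zero _ _ ho
      rw [hs, ← hwn, ← norm_smul, ← norm_neg (w • k)]
      simpa [sq] using this
    have hmin : 0 < min m (ε - z.re) := lt_min hm (sub_pos.2 hz)
    have b1 : min m (ε - z.re) * ‖k‖ ≤ ‖z‖ * ‖k‖ :=
      (mul_le_mul_of_nonneg_right (min_le_left _ _) (norm_nonneg _)).trans (hmk k hk)
    have b2 : min m (ε - z.re) * ‖v‖ ≤ ‖y - w • v‖ :=
      (mul_le_mul_of_nonneg_right (min_le_right _ _) (norm_nonneg _)).trans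
        (hwre ▸ norm_sub_smul_ge_of_re_inner_ge (hε v y hvy hv))
    refine le_of_sq_le_sq ?_ (norm_nonneg _)
    rw [e2, mul_pow, e1, mul_add, ← mul_pow, ← mul_pow]
    gcongr
  exact isResolventPoint_of_bound hA (lt_min hm (sub_pos.2 hz)) (lt_min hm (sub_pos.2 hz))
    (key z rfl rfl) (key _ (Complex.conj_re z) (Complex.norm_conj z))

end SelfAdjoint

/-! ### The kernel and range of `□` in terms of T₁ and T₂. -/

section Box

variable {H₁ H₂ H₃ : Type*}
  [NormedAddCommGroup H₁] [InnerProductSpace ℂ H₁] [CompleteSpace H₁]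
  [NormedAddCommGroup H₂] [InnerProductSpace ℂ H₂] [CompleteSpace H₂]
  [NormedAddCommGroup H₃] [InnerProductSpace ℂ H₃] [CompleteSpace H₃]
  {T₁ : H₁ →ₗ.[ℂ] H₂} {T₂ : H₂ →ₗ.[ℂ] H₃}

theorem mem_graph_box (hc₁ : T₁.IsClosed)
    (hd₂ : Dense (T₂.domain : Set H₂)) (hc₂ : T₂.IsClosed)
    (h : opRange T₁ ≤ opKer T₂) {u w : H₂} :
    (u, w) ∈ (box T₁ T₂).graph ↔ ∃ a b, (u, a) ∈ T₁†.graph ∧ (u, b) ∈ T₂.graph ∧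
      ∀ v a' b', (v, a') ∈ T₁†.graph → (v, b') ∈ T₂.graph →
        ⟪a, a'⟫_ℂ + ⟪b, b'⟫_ℂ = ⟪w, v⟫_ℂ := by
  rw [graph_box hc₁ hd₂ hc₂ h]
  constructor
  · rintro ⟨u, rfl, hu⟩
    refine ⟨_, _, T₁†.mem_graph ⟨u, u.2.1⟩, T₂.mem_graph ⟨u, u.2.2⟩, fun v a' b' ha' hb' => ?_⟩
    obtain ⟨v, rfl, rfl⟩ := (LinearPMap.mem_graph_iff _).1 ha'
    obtain ⟨v', hv', rfl⟩ := (LinearPMap.mem_graph_iff _).1 hb'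
    have hv2 : (v : H₂) ∈ T₂.domain := by
      have : (v' : H₂) = v := hv'
      exact this ▸ v'.2
    obtain rfl : v' = ⟨v, hv2⟩ := Subtype.ext hv'
    exact hu ⟨v, v.2, hv2⟩
  · rintro ⟨a, b, ha, hb, hu⟩
    obtain ⟨u, rfl, rfl⟩ := (LinearPMap.mem_graph_iff _).1 ha
    obtain ⟨u', hu', rfl⟩ := (LinearPMap.mem_graph_iff _).1 hb
    have hu2 : (u : H₂) ∈ T₂.domain := by
      have : (u' : H₂) = u := hu'
      exact this ▸ u'.2
    obtain rfl : u' = ⟨u, hu2⟩ := Subtype.ext hu'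
    exact ⟨⟨u, u.2, hu2⟩, rfl, fun v => hu _ _ _ (T₁†.mem_graph ⟨v, v.2.1⟩)
      (T₂.mem_graph ⟨v, v.2.2⟩)⟩

theorem exists_of_mem_graph_box (hc₁ : T₁.IsClosed)
    (hd₂ : Dense (T₂.domain : Set H₂)) (hc₂ : T₂.IsClosed)
    (h : opRange T₁ ≤ opKer T₂) {u w : H₂} (huw : (u, w) ∈ (box T₁ T₂).graph) :
    ∃ a b, (u, a) ∈ T₁†.graph ∧ (u, b) ∈ T₂.graph ∧
      (⟪w, u⟫_ℂ).re = ‖a‖ ^ 2 + ‖b‖ ^ 2 := by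
  obtain ⟨a, b, ha, hb, hu⟩ := (mem_graph_box hc₁ hd₂ hc₂ h).1 huw
  refine ⟨a, b, ha, hb, ?_⟩
  rw [← hu u a b ha hb, Complex.add_re]
  exact congrArg₂ (· + ·) (inner_self_eq_norm_sq (𝕜 := ℂ) a) (inner_self_eq_norm_sq (𝕜 := ℂ) b)

/-- The kernel of `□` consists of the harmonic elements. -/
theorem mem_opKer_box (hc₁ : T₁.IsClosed)
    (hd₂ : Dense (T₂.domain : Set H₂)) (hc₂ : T₂.IsClosed)
    (h : opRange T₁ ≤ opKer T₂) {u : H₂} :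
    u ∈ opKer (box T₁ T₂) ↔ (u, (0 : H₁)) ∈ T₁†.graph ∧ (u, (0 : H₃)) ∈ T₂.graph := by
  rw [mem_opKer_iff_graph]
  constructor
  · intro hu
    obtain ⟨a, b, ha, hb, hab⟩ := exists_of_mem_graph_box hc₁ hd₂ hc₂ h hu
    rw [inner_zero_left, Complex.zero_re] at hab
    have ha0 : a = 0 := by
      rw [← norm_eq_zero]; nlinarith [sq_nonneg ‖a‖, sq_nonneg ‖b‖]
    have hb0 : b = 0 := by
      rw [← norm_eq_zero]; nlinarith [sq_nonneg ‖a‖, sq_nonneg ‖b‖]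
    exact ⟨ha0 ▸ ha, hb0 ▸ hb⟩
  · rintro ⟨ha, hb⟩
    exact (mem_graph_box hc₁ hd₂ hc₂ h).2 ⟨0, 0, ha, hb, by simp⟩

theorem opKer_box_le (hc₁ : T₁.IsClosed)
    (hd₂ : Dense (T₂.domain : Set H₂)) (hc₂ : T₂.IsClosed)
    (h : opRange T₁ ≤ opKer T₂) : opKer (box T₁ T₂) ≤ opKer T₂ := fun _ hu =>
  mem_opKer_iff_graph.2 ((mem_opKer_box hc₁ hd₂ hc₂ h).1 hu).2

theorem opKer_box_le_formDomain (hc₁ : T₁.IsClosed)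
    (hd₂ : Dense (T₂.domain : Set H₂)) (hc₂ : T₂.IsClosed)
    (h : opRange T₁ ≤ opKer T₂) : opKer (box T₁ T₂) ≤ formDomain T₁ T₂ := fun _ hu =>
  have hu' := (mem_opKer_box hc₁ hd₂ hc₂ h).1 hu
  ⟨LinearPMap.mem_domain_of_mem_graph hu'.1, LinearPMap.mem_domain_of_mem_graph hu'.2⟩

theorem mem_graph_adjoint_zero_iff (hd₁ : Dense (T₁.domain : Set H₁)) {u : H₂} :
    (u, (0 : H₁)) ∈ T₁†.graph ↔ u ∈ (opRange T₁)ᗮ := by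
  rw [mem_graph_adjoint_iff hd₁, Submodule.mem_orthogonal']
  simp only [inner_zero_left, mem_opRange_iff_graph]
  exact ⟨fun hu b ⟨a, hab⟩ => hu a b hab, fun hu a b hab => hu b ⟨a, hab⟩⟩

theorem opRange_le_orthogonal_opKer_box (hd₁ : Dense (T₁.domain : Set H₁)) (hc₁ : T₁.IsClosed)
    (hd₂ : Dense (T₂.domain : Set H₂)) (hc₂ : T₂.IsClosed)
    (h : opRange T₁ ≤ opKer T₂) : opRange T₁ ≤ (opKer (box T₁ T₂))ᗮ := fun _ hx =>
  (Submodule.mem_orthogonal' _ _).2 fun _ hu => (Submodule.mem_orthogonal _ _).1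
    ((mem_graph_adjoint_zero_iff hd₁).1 ((mem_opKer_box hc₁ hd₂ hc₂ h).1 hu).1) _ hx

/-- N(T₂)ᗮ ⊂ R(T₁)ᗮ = N(T₁*). This decouples the two terms of the form. -/
theorem graph_adjoint_of_mem_orthogonal_opKer (hd₁ : Dense (T₁.domain : Set H₁))
    (h : opRange T₁ ≤ opKer T₂) {u : H₂} (hu : u ∈ (opKer T₂)ᗮ) :
    (u, (0 : H₁)) ∈ T₁†.graph :=
  (mem_graph_adjoint_zero_iff hd₁).2 (Submodule.orthogonal_le h hu)

/-- If f = `□ u` and T₂ f = 0, then f = T₁(T₁* u). Testing the form against the N(T₂)-component of v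
∈ dom(T₁*) leaves (T₁* u, T₁* v) = (f, v), and T₁** = T₁ concludes. -/
theorem opKer_inf_opRange_box_le (hd₁ : Dense (T₁.domain : Set H₁)) (hc₁ : T₁.IsClosed)
    (hd₂ : Dense (T₂.domain : Set H₂)) (hc₂ : T₂.IsClosed)
    (h : opRange T₁ ≤ opKer T₂) : opKer T₂ ⊓ opRange (box T₁ T₂) ≤ opRange T₁ := by
  rintro f ⟨hf, hf'⟩
  obtain ⟨u, hu⟩ := mem_opRange_iff_graph.1 hf'
  obtain ⟨g, b, -, -, hQ⟩ := (mem_graph_box hc₁ hd₂ hc₂ h).1 hu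
  refine mem_opRange_iff_graph.2 ⟨g, mem_graph_of_forall_adjoint hd₁ hc₁ fun v w hvw => ?_⟩
  have : CompleteSpace (opKer T₂) := (isClosed_opKer hc₂).completeSpace_coe
  obtain ⟨k, hk, v', hv', rfl⟩ := (opKer T₂).exists_add_mem_mem_orthogonal v
  have hkw : (k, w) ∈ T₁†.graph := by
    simpa using T₁†.graph.sub_mem hvw (graph_adjoint_of_mem_orthogonal_opKer hd₁ h hv')
  have := hQ k w 0 hkw (mem_opKer_iff_graph.1 hk)
  rw [inner_zero_right, add_zero] at this
  rw [inner_add_right, (Submodule.mem_orthogonal _ _).1 hv' f hf, add_zero, this]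

/-- If `□` has closed range, then its range is the complement of its kernel. -/
theorem opRange_box_eq (hd₁ : Dense (T₁.domain : Set H₁)) (hc₁ : T₁.IsClosed)
    (hd₂ : Dense (T₂.domain : Set H₂)) (hc₂ : T₂.IsClosed)
    (h : opRange T₁ ≤ opKer T₂) (hr : IsClosed (opRange (box T₁ T₂) : Set H₂)) :
    opRange (box T₁ T₂) = (opKer (box T₁ T₂))ᗮ := by
  have : CompleteSpace (opRange (box T₁ T₂)) := hr.completeSpace_coe
  rw [← orthogonal_opRange_of_isSelfAdjoint (isSelfAdjoint_box hd₁ hc₁ hd₂ hc₂ h),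
    Submodule.orthogonal_orthogonal]

theorem opKer_inf_orthogonal_opKer_box (hd₁ : Dense (T₁.domain : Set H₁)) (hc₁ : T₁.IsClosed)
    (hd₂ : Dense (T₂.domain : Set H₂)) (hc₂ : T₂.IsClosed)
    (h : opRange T₁ ≤ opKer T₂) (hr : IsClosed (opRange (box T₁ T₂) : Set H₂)) :
    opKer T₂ ⊓ (opKer (box T₁ T₂))ᗮ = opRange T₁ := by
  refine le_antisymm ?_ (le_inf h (opRange_le_orthogonal_opKer_box hd₁ hc₁ hd₂ hc₂ h))
  rw [← opRange_box_eq hd₁ hc₁ hd₂ hc₂ h hr]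
  exact opKer_inf_opRange_box_le hd₁ hc₁ hd₂ hc₂ h

theorem isClosed_opRange_of_box (hd₁ : Dense (T₁.domain : Set H₁)) (hc₁ : T₁.IsClosed)
    (hd₂ : Dense (T₂.domain : Set H₂)) (hc₂ : T₂.IsClosed)
    (h : opRange T₁ ≤ opKer T₂) (hr : IsClosed (opRange (box T₁ T₂) : Set H₂)) :
    IsClosed (opRange T₂ : Set H₃) := by
  obtain ⟨C, hC, hbd⟩ := exists_preimage_norm_le_of_isClosed_opRange
    (isSelfAdjoint_box hd₁ hc₁ hd₂ hc₂ h).isClosed hr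
  -- Write u = `□ w` with ‖w‖ ≤ C‖u‖. Then ‖T₂ w‖² ≤ Q(w, w) = (u, w) ≤ C‖u‖², while T₁* u = 0 gives
  -- ‖u‖² = (T₂ w, T₂ u) ≤ √C ‖u‖ ‖T₂ u‖.
  refine isClosed_opRange_of_bound hc₂ (c := (√C)⁻¹) (by positivity) fun u y huy hu => ?_
  have hu1 := graph_adjoint_of_mem_orthogonal_opKer hd₁ h hu
  have hur : u ∈ opRange (box T₁ T₂) := by
    rw [opRange_box_eq hd₁ hc₁ hd₂ hc₂ h hr]
    exact Submodule.orthogonal_le (opKer_box_le hc₁ hd₂ hc₂ h) hu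
  obtain ⟨w, hw, hwC⟩ := hbd u hur
  obtain ⟨a, b, ha, hb, hQ⟩ := (mem_graph_box hc₁ hd₂ hc₂ h).1 hw
  have e1 : ⟪b, y⟫_ℂ = ⟪u, u⟫_ℂ := by
    have := hQ u 0 y hu1 huy
    rwa [inner_zero_right, zero_add] at this
  have e2 : ‖a‖ ^ 2 + ‖b‖ ^ 2 ≤ C * ‖u‖ ^ 2 := by
    have h1 : ‖a‖ ^ 2 + ‖b‖ ^ 2 = (⟪u, w⟫_ℂ).re := by
      rw [← hQ w a b ha hb, Complex.add_re]
      exact (congrArg₂ (· + ·) (inner_self_eq_norm_sq (𝕜 := ℂ) a)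
        (inner_self_eq_norm_sq (𝕜 := ℂ) b)).symm
    have h2 : (⟪u, w⟫_ℂ).re ≤ ‖u‖ * ‖w‖ := re_inner_le_norm (𝕜 := ℂ) _ _
    nlinarith [norm_nonneg u]
  have e3 : ‖u‖ ^ 2 ≤ ‖b‖ * ‖y‖ := by
    have h1 : (⟪u, u⟫_ℂ).re = ‖u‖ ^ 2 := inner_self_eq_norm_sq (𝕜 := ℂ) u
    rw [← h1, ← e1]
    exact re_inner_le_norm (𝕜 := ℂ) _ _
  have e4 : ‖b‖ ≤ √C * ‖u‖ := by
    refine le_of_sq_le_sq ?_ (by positivity)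
    rw [mul_pow, Real.sq_sqrt hC.le]
    nlinarith [sq_nonneg ‖a‖]
  rw [inv_mul_eq_div, div_le_iff₀ (by positivity)]
  rcases (norm_nonneg u).eq_or_lt with h0 | h0
  · rw [← h0]; positivity
  · refine le_of_mul_le_mul_right ?_ h0
    nlinarith [norm_nonneg y]

/-- The form `Q` is bounded from below off the harmonic elements if `T₁` and `T₂` have
closed range. -/
theorem exists_form_bound (hd₁ : Dense (T₁.domain : Set H₁)) (hc₁ : T₁.IsClosed)
    (hd₂ : Dense (T₂.domain : Set H₂)) (hc₂ : T₂.IsClosed)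
    (h : opRange T₁ ≤ opKer T₂) (hr₁ : IsClosed (opRange T₁ : Set H₂))
    (hr₂ : IsClosed (opRange T₂ : Set H₃)) :
    ∃ ε > 0, ∀ u a b, (u, a) ∈ T₁†.graph → (u, b) ∈ T₂.graph →
      u ∈ (opKer (box T₁ T₂))ᗮ → ε * ‖u‖ ^ 2 ≤ ‖a‖ ^ 2 + ‖b‖ ^ 2 := by
  obtain ⟨C₁, hC₁, hb₁⟩ := exists_preimage_norm_le_of_isClosed_opRange hc₁ hr₁
  obtain ⟨C₂, hC₂, hb₂⟩ := exists_preimage_norm_le_of_isClosed_opRange hc₂ hr₂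
  refine ⟨(C₁ ^ 2 + C₂ ^ 2)⁻¹, by positivity, fun u a b ha hb hu => ?_⟩
  obtain ⟨k, hk, v, hv, rfl, hvb⟩ := exists_ker_add_orthogonal hc₂ hb
  have hka : (k, a) ∈ T₁†.graph := by
    simpa using T₁†.graph.sub_mem ha (graph_adjoint_of_mem_orthogonal_opKer hd₁ h hv)
  have hkv : ‖k + v‖ ^ 2 = ‖k‖ ^ 2 + ‖v‖ ^ 2 := by
    simpa [sq] using norm_add_sq_eq_norm_sq_add_norm_sq_of_inner_eq_zero k v
      ((Submodule.mem_orthogonal _ _).1 hv k hk)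
  have hkK : k ∈ (opKer (box T₁ T₂))ᗮ := by
    have := Submodule.sub_mem _ hu (Submodule.orthogonal_le (opKer_box_le hc₁ hd₂ hc₂ h) hv)
    rwa [add_sub_cancel_right] at this
  -- The part of `k` orthogonal to the closed range of T₁ is harmonic, whereas `k` is orthogonal to
  -- all harmonic elements; so that part vanishes.
  have hkr : k ∈ opRange T₁ := by
    have : CompleteSpace (opRange T₁) := hr₁.completeSpace_coe
    obtain ⟨r, hr, s, hs, rfl⟩ := (opRange T₁).exists_add_mem_mem_orthogonal k
    have hsK : s ∈ opKer (box T₁ T₂) := by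
      refine (mem_opKer_box hc₁ hd₂ hc₂ h).2
        ⟨(mem_graph_adjoint_zero_iff hd₁).2 hs, mem_opKer_iff_graph.1 ?_⟩
      simpa using (opKer T₂).sub_mem hk (h hr)
    have h0 := (Submodule.mem_orthogonal' _ _).1 hkK s hsK
    rw [inner_add_left, (Submodule.mem_orthogonal _ _).1 hs r hr, zero_add] at h0
    rw [inner_self_eq_zero.1 h0, add_zero]
    exact hr
  have bk : ‖k‖ ≤ C₁ * ‖a‖ := by
    obtain ⟨x, hx, hxC⟩ := hb₁ k hkr
    have h1 : ⟪k, k⟫_ℂ = ⟪a, x⟫_ℂ := (mem_graph_adjoint_iff hd₁).1 hka _ _ hx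
    have h2 : ‖k‖ ^ 2 ≤ ‖a‖ * ‖x‖ := by
      have h3 : (⟪k, k⟫_ℂ).re = ‖k‖ ^ 2 := inner_self_eq_norm_sq (𝕜 := ℂ) k
      rw [← h3, h1]
      exact re_inner_le_norm (𝕜 := ℂ) _ _
    rcases (norm_nonneg k).eq_or_lt with h0 | h0
    · rw [← h0]; positivity
    · refine le_of_mul_le_mul_right ?_ h0
      nlinarith [norm_nonneg a]
  -- Being orthogonal to N(T₂), `v` is the preimage of `b` of least norm.
  have bv : ‖v‖ ≤ C₂ * ‖b‖ := by
    obtain ⟨x, hx, hxC⟩ := hb₂ b (mem_opRange_iff_graph.2 ⟨v, hvb⟩)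
    refine le_trans ?_ hxC
    have hxv : x - v ∈ opKer T₂ := mem_opKer_iff_graph.2 (by simpa using T₂.graph.sub_mem hx hvb)
    have := norm_add_sq_eq_norm_sq_add_norm_sq_of_inner_eq_zero (x - v) v
      ((Submodule.mem_orthogonal _ _).1 hv _ hxv)
    rw [sub_add_cancel] at this
    refine le_of_sq_le_sq ?_ (norm_nonneg _)
    nlinarith [sq_nonneg ‖x - v‖]
  rw [inv_mul_le_iff₀ (by positivity), hkv]
  have bk2 : ‖k‖ ^ 2 ≤ C₁ ^ 2 * ‖a‖ ^ 2 := by rw [← mul_pow]; gcongr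
  have bv2 : ‖v‖ ^ 2 ≤ C₂ ^ 2 * ‖b‖ ^ 2 := by rw [← mul_pow]; gcongr
  nlinarith [mul_nonneg (sq_nonneg C₁) (sq_nonneg ‖b‖), mul_nonneg (sq_nonneg C₂) (sq_nonneg ‖a‖)]

theorem exists_box_bound (hd₁ : Dense (T₁.domain : Set H₁)) (hc₁ : T₁.IsClosed)
    (hd₂ : Dense (T₂.domain : Set H₂)) (hc₂ : T₂.IsClosed)
    (h : opRange T₁ ≤ opKer T₂) (hr₁ : IsClosed (opRange T₁ : Set H₂))
    (hr₂ : IsClosed (opRange T₂ : Set H₃)) :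
    ∃ ε > 0, ∀ u w, (u, w) ∈ (box T₁ T₂).graph →
      u ∈ (opKer (box T₁ T₂))ᗮ → ε * ‖u‖ ^ 2 ≤ (⟪w, u⟫_ℂ).re := by
  obtain ⟨ε, hε, hb⟩ := exists_form_bound hd₁ hc₁ hd₂ hc₂ h hr₁ hr₂
  refine ⟨ε, hε, fun u w huw hu => ?_⟩
  obtain ⟨a, b, ha, hb', hQ⟩ := exists_of_mem_graph_box hc₁ hd₂ hc₂ h huw
  exact hQ ▸ hb u a b ha hb' hu

/-! ### The two equivalences. -/

theorem infSet_spec_box_pos_iff (hd₁ : Dense (T₁.domain : Set H₁)) (hc₁ : T₁.IsClosed)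
    (hd₂ : Dense (T₂.domain : Set H₂)) (hc₂ : T₂.IsClosed)
    (h : opRange T₁ ≤ opKer T₂) :
    0 < infSet (spec (box T₁ T₂)) ↔
      IsClosed (opRange T₂ : Set H₃) ∧ opRange T₁ = opKer T₂ := by
  constructor
  · intro hpos
    have hres : IsResolventPoint (box T₁ T₂) 0 := not_not.1 (zero_notMem_of_infSet_pos hpos)
    have hker := hres.opKer_eq_bot
    have hran := hres.opRange_eq_top
    rw [subScalar_zero] at hker hran
    have hr : IsClosed (opRange (box T₁ T₂) : Set H₂) := by rw [hran]; exact isClosed_univ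
    refine ⟨isClosed_opRange_of_box hd₁ hc₁ hd₂ hc₂ h hr, ?_⟩
    rw [← opKer_inf_orthogonal_opKer_box hd₁ hc₁ hd₂ hc₂ h hr, hker, Submodule.bot_orthogonal_eq_top,
      inf_top_eq]
  · rintro ⟨hr₂, heq⟩
    have hr₁ : IsClosed (opRange T₁ : Set H₂) := heq ▸ isClosed_opKer hc₂
    obtain ⟨ε, hε, hb⟩ := exists_box_bound hd₁ hc₁ hd₂ hc₂ h hr₁ hr₂
    -- A harmonic element lies in N(T₂) = R(T₁) and is orthogonal to R(T₁).
    have hker : opKer (box T₁ T₂) = ⊥ := (Submodule.eq_bot_iff _).2 fun u hu => by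
      have hu1 := opKer_box_le hc₁ hd₂ hc₂ h hu
      rw [← heq] at hu1
      exact inner_self_eq_zero.1 ((Submodule.mem_orthogonal _ _).1
        (opRange_le_orthogonal_opKer_box hd₁ hc₁ hd₂ hc₂ h hu1) u hu)
    refine infSet_pos hε fun z hz => not_lt.1 fun hlt => hz ?_
    exact isResolventPoint_of_re_inner_ge (isSelfAdjoint_box hd₁ hc₁ hd₂ hc₂ h) hb hlt (.inr hker)

theorem infSet_essSpec_box_pos_iff (hd₁ : Dense (T₁.domain : Set H₁)) (hc₁ : T₁.IsClosed)
    (hd₂ : Dense (T₂.domain : Set H₂)) (hc₂ : T₂.IsClosed)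
    (h : opRange T₁ ≤ opKer T₂) :
    0 < infSet (essSpec (box T₁ T₂)) ↔
      ∃ L : Submodule ℂ H₂, FiniteDimensional ℂ L ∧ L ≤ formDomain T₁ T₂ ∧
        IsClosed (opRange (T₂.domRestrict Lᗮ) : Set H₃) ∧
        opRange T₁ ⊓ Lᗮ = opKer T₂ ⊓ Lᗮ := by
  have hsa := isSelfAdjoint_box hd₁ hc₁ hd₂ hc₂ h
  constructor
  · intro hpos
    have hfr : IsFredholmOp (subScalar (box T₁ T₂) 0) := not_not.1 (zero_notMem_of_infSet_pos hpos)
    rw [subScalar_zero] at hfr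
    have := hfr.finite_ker
    refine ⟨opKer (box T₁ T₂), hfr.finite_ker, opKer_box_le_formDomain hc₁ hd₂ hc₂ h, ?_, ?_⟩
    · rw [opRange_domRestrict_of_le_opKer (opKer_box_le hc₁ hd₂ hc₂ h)]
      exact isClosed_opRange_of_box hd₁ hc₁ hd₂ hc₂ h hfr.closed_range
    · rw [opKer_inf_orthogonal_opKer_box hd₁ hc₁ hd₂ hc₂ h hfr.closed_range]
      exact inf_eq_left.2 (opRange_le_orthogonal_opKer_box hd₁ hc₁ hd₂ hc₂ h)
  · rintro ⟨L, hL, hLQ, hrL, heq⟩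
    have hr₂ := isClosed_opRange_of_domRestrict (hLQ.trans inf_le_right) hrL
    have hr₁ : IsClosed (opRange T₁ : Set H₂) := by
      refine isClosed_of_inf_orthogonal (L := L) ?_
      rw [heq]
      exact (isClosed_opKer hc₂).inter (Submodule.isClosed_orthogonal L)
    -- A harmonic element of `Lᗮ` lies in R(T₁) by `heq` and is orthogonal to R(T₁), so ker □ meets
    -- `Lᗮ` trivially.
    have hfin : FiniteDimensional ℂ (opKer (box T₁ T₂)) := by
      refine finiteDimensional_of_inf_orthogonal_eq_bot (L := L) ((Submodule.eq_bot_iff _).2 ?_)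
      rintro u ⟨hu, huL⟩
      have hu1 : u ∈ opRange T₁ ⊓ Lᗮ := by
        rw [heq]
        exact ⟨opKer_box_le hc₁ hd₂ hc₂ h hu, huL⟩
      exact inner_self_eq_zero.1 ((Submodule.mem_orthogonal _ _).1
        (opRange_le_orthogonal_opKer_box hd₁ hc₁ hd₂ hc₂ h hu1.1) u hu)
    obtain ⟨ε, hε, hb⟩ := exists_box_bound hd₁ hc₁ hd₂ hc₂ h hr₁ hr₂
    refine infSet_pos hε fun z hz => not_lt.1 fun hlt => hz ?_
    -- Below ε only z = 0 can be spectral, with eigenspace ker □; Fredholmness there comes from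
    -- `hfin` and the lower bound off the kernel.
    rcases eq_or_ne z 0 with rfl | hz0
    · rw [subScalar_zero]
      refine isFredholmOp_of_isSelfAdjoint hsa hfin
        (isClosed_opRange_of_bound hsa.isClosed hε fun u w huw hu => ?_)
      simpa using norm_sub_smul_ge_of_re_inner_ge (z := 0) (hb u w huw hu)
    · exact (isResolventPoint_of_re_inner_ge hsa hb hlt (.inl hz0)).isFredholmOp

end Box

end SpectralLemma

end

open SpectralLemma in
theorem lemma2p1 {H₁ H₂ H₃ : Type*}
    [NormedAddCommGroup H₁] [InnerProductSpace ℂ H₁] [CompleteSpace H₁]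
    [NormedAddCommGroup H₂] [InnerProductSpace ℂ H₂] [CompleteSpace H₂]
    [NormedAddCommGroup H₃] [InnerProductSpace ℂ H₃] [CompleteSpace H₃]
    (T₁ : H₁ →ₗ.[ℂ] H₂) (T₂ : H₂ →ₗ.[ℂ] H₃)
    (hd₁ : Dense (T₁.domain : Set H₁)) (hc₁ : T₁.IsClosed)
    (hd₂ : Dense (T₂.domain : Set H₂)) (hc₂ : T₂.IsClosed)
    (h : opRange T₁ ≤ opKer T₂) :
    (0 < infSet (spec (box T₁ T₂)) ↔
      IsClosed (opRange T₂ : Set H₃) ∧ opRange T₁ = opKer T₂) ∧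
    (0 < infSet (essSpec (box T₁ T₂)) ↔
      ∃ L : Submodule ℂ H₂, FiniteDimensional ℂ L ∧ L ≤ formDomain T₁ T₂ ∧
        IsClosed (opRange (T₂.domRestrict Lᗮ) : Set H₃) ∧
        opRange T₁ ⊓ Lᗮ = opKer T₂ ⊓ Lᗮ) :=
  ⟨infSet_spec_box_pos_iff hd₁ hc₁ hd₂ hc₂ h, infSet_essSpec_box_pos_iff hd₁ hc₁ hd₂ hc₂ h⟩
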